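/- Let $n\ge 0$ and consider $2n$ bosonic modes ($\hbar=1$, $a_m=(x_m+ip_m)/\sqrt2$), split equally into $n$ modes $\vec a_A$ and $n$ modes $\vec a_B$, with Hilbert space $L^2(\mathbb R^n)\otimes L^2(\mathbb R^n)=L^2(\mathbb R^n\times\mathbb R^n)$. Let $\rho$ be a density operator on this space, i.e. a positive semidefinite operator of trace one. * Let $\rho^{T_B}$ denote the partial transpose of $\rho$ over the modes $\vec a_B$ in the position (equivalently, Fock) basis, i.e. the bounded operator with $\langle\varphi\otimes\psi,\rho^{T_B}(\varphi'\otimes\psi')\rangle=\langle\varphi\otimes\overline{\psi'},\rho\,(\varphi'\otimes\overline{\psi})\rangle$ for all $\varphi,\varphi',\psi,\psi'\in L^2(\mathbb R^n)$. * Let $\operatorname{tr}_-\rho$ denote the partial trace of $\rho$ over the collective modes $\vec a_-=(\vec a_A-\vec a_B)/\sqrt2$, a state of the $n$ modes $\vec a_+=(\vec a_A+\vec a_B)/\sqrt2$. That is, $\operatorname{tr}_-\rho=\operatorname{tr}_2(U\rho U^\dagger)$, where $(U\psi)(x_+,x_-)=\psi\big(\tfrac{x_++x_-}{\sqrt2},\tfrac{x_+-x_-}{\sqrt2}\big)$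 and $\operatorname{tr}_2$ is the partial trace over the second tensor factor. * For a trace-class operator $O$ on $L^2(\mathbb R^n)$, let $W_O(\vec\alpha)=(2/\pi)^n\operatorname{tr}[O\,D(\vec\alpha)\,\Pi\,D(\vec\alpha)^\dagger]$, $\vec\alpha\in\mathbb C^n$, denote its Wigner function, where $D(\vec\alpha)=\exp\big(\sum_m\alpha_m a_m^\dagger-\alpha_m^*a_m\big)$ is the displacement operator and $(\Pi f)(x)=f(-x)$ is the parity operator. If the Wigner function $W_{\operatorname{tr}_-\rho}$ is not everywhere nonnegative (i.e. it takes a negative value at some $\vec\alpha\in\mathbb C^n$), then $\rho^{T_B}$ is not positive semidefinite. Equivalently, if $\rho^{T_B}\succeq0$, then $W_{\operatorname{tr}_-\rho}(\vec\alpha)\ge0$ for all $\vec\alpha\in\mathbb C^n$. -/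

import Mathlib

open scoped ComplexOrder

noncomputable section

namespace WignerPPT

open MeasureTheory Complex ContinuousLinearMap

/-! Throughout `ħ = 1`, and the modes are realized in the Schrödinger (position) representation,
with annihilation operators `a = (x + i p) / √2`, `p = -i ∂/∂x`. -/

/-- Configuration space `ℝⁿ` of `n` bosonic modes. -/
abbrev Config (n : ℕ) : Type := EuclideanSpace ℝ (Fin n)

/-- The Hilbert space `L²(ℝⁿ; ℂ)` of `n` modes. -/
abbrev ModeSpace (n : ℕ) : Type := Lp ℂ 2 (volume : Measure (Config n))

/-- The Hilbert space `L²(ℝⁿ × ℝⁿ; ℂ)` of `2n` modes split into `n` modes `A` (first factor) and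
`n` modes `B` (second factor). -/
abbrev BipartiteSpace (n : ℕ) : Type :=
  Lp ℂ 2 ((volume : Measure (Config n)).prod (volume : Measure (Config n)))

/-! ### Trace and density operators -/

section Trace

variable (E : Type*) [NormedAddCommGroup E] [InnerProductSpace ℂ E] [CompleteSpace E]

/-- The index set of a fixed orthonormal basis of the Hilbert space `E`. -/
def basisIndex : Set E := (exists_hilbertBasis ℂ E).choose

/-- A fixed orthonormal basis of the Hilbert space `E`. -/
def basis : HilbertBasis (basisIndex E) ℂ E := (exists_hilbertBasis ℂ E).choose_spec.choose

variable {E}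

/-- The trace `∑ᵢ ⟨eᵢ, T eᵢ⟩`. For a trace-class operator the series converges absolutely and its
sum does not depend on the orthonormal basis. -/
def trace (T : E →L[ℂ] E) : ℂ := ∑' i, inner ℂ (basis E i) (T (basis E i))

/-- A density operator (quantum state): a positive operator of trace one. For a positive operator
the value of the series of diagonal elements does not depend on the orthonormal basis. -/
structure IsDensityOperator (ρ : E →L[ℂ] E) : Prop where
  isPositive : ρ.IsPositive
  hasSum_trace : HasSum (fun i => inner ℂ (basis E i) (ρ (basis E i))) 1

end Trace

/-! ### Displacement operators, parity, and the Wigner function -/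

section Wigner

variable {n : ℕ}

theorem memLp_phase_mul {X : Type*} [MeasurableSpace X] {μ : Measure X} {θ : X → ℝ}
    (hθ : Measurable θ) (f : Lp ℂ 2 μ) : MemLp (fun x => exp (θ x * I) * f x) 2 μ := by
  have hm : Measurable fun x => exp (θ x * I) := by fun_prop
  refine (Lp.memLp f).of_le (hm.aestronglyMeasurable.mul (Lp.aestronglyMeasurable f)) ?_
  exact Filter.Eventually.of_forall fun x => by simp [norm_exp_ofReal_mul_I]

/-- Multiplication by the phase `exp (i θ(x))` on `L²`. -/
def phaseMul {X : Type*} [MeasurableSpace X] {μ : Measure X} (θ : X → ℝ) (hθ : Measurable θ) :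
    Lp ℂ 2 μ →ₗᵢ[ℂ] Lp ℂ 2 μ where
  toFun f := (memLp_phase_mul hθ f).toLp _
  map_add' f g := by
    rw [← MemLp.toLp_add]
    refine MemLp.toLp_congr _ _ ?_
    filter_upwards [Lp.coeFn_add f g] with x hx
    simp only [hx, Pi.add_apply, mul_add]
  map_smul' c f := by
    rw [RingHom.id_apply, ← MemLp.toLp_const_smul]
    refine MemLp.toLp_congr _ _ ?_
    filter_upwards [Lp.coeFn_smul c f] with x hx
    simp [hx, mul_left_comm]
  norm_map' f := by
    change ‖(memLp_phase_mul hθ f).toLp _‖ = ‖f‖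
    rw [Lp.norm_toLp, Lp.norm_def]
    congr 1
    exact eLpNorm_congr_norm_ae
      (Filter.Eventually.of_forall fun x => by simp [norm_exp_ofReal_mul_I])

/-- The position `√2 Re α` of the phase-space point `α = (q + i p) / √2`. -/
def pos (α : Fin n → ℂ) : Config n := WithLp.toLp 2 fun m => √2 * (α m).re

/-- The momentum `√2 Im α` of the phase-space point `α = (q + i p) / √2`. -/
def mom (α : Fin n → ℂ) : Config n := WithLp.toLp 2 fun m => √2 * (α m).im

/-- The translation `f ↦ f(· - q)`. -/
def translation (q : Config n) : ModeSpace n →L[ℂ] ModeSpace n :=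
  (Lp.compMeasurePreservingₗᵢ ℂ (fun x : Config n => x - q)
    (measurePreserving_sub_right volume q)).toContinuousLinearMap

/-- The displacement operator `D(α) = exp(∑ₘ αₘ aₘ† - αₘ* aₘ)`; for `α = (q + i p) / √2` it acts on
wave functions as `(D(α) f)(x) = exp(i (p · x - p · q / 2)) f(x - q)`. -/
def displacement (α : Fin n → ℂ) : ModeSpace n →L[ℂ] ModeSpace n :=
  (phaseMul (fun x : Config n => inner ℝ (mom α) x - inner ℝ (mom α) (pos α) / 2)
    (by fun_prop)).toContinuousLinearMap ∘L translation (pos α)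

/-- The parity operator `f ↦ f(-·)`. -/
def parity (n : ℕ) : ModeSpace n →L[ℂ] ModeSpace n :=
  (Lp.compMeasurePreservingₗᵢ ℂ (fun x : Config n => -x)
    (Measure.measurePreserving_neg volume)).toContinuousLinearMap

/-- The Wigner function `W_O(α) = (2/π)ⁿ tr[O D(α) Π D(α)†]` of a trace-class operator `O` on `n`
modes, where `Π` is the parity operator. It is normalized with respect to the measure
`∏ₘ d(Re αₘ) d(Im αₘ)`, and its symplectic Fourier transform is the characteristic function
`ξ ↦ tr[O D(ξ)]`. Its values are real when `O` is self-adjoint. -/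
def wigner (O : ModeSpace n →L[ℂ] ModeSpace n) (α : Fin n → ℂ) : ℂ :=
  ((2 / Real.pi : ℝ) : ℂ) ^ n *
    trace (O ∘L displacement α ∘L parity n ∘L adjoint (displacement α))

end Wigner

/-! ### Tensor products of vectors, partial trace and partial transpose -/

section Bipartite

variable {n : ℕ}

theorem memLp_tensor (φ ψ : ModeSpace n) :
    MemLp (fun z : Config n × Config n => φ z.1 * ψ z.2) 2
      ((volume : Measure (Config n)).prod (volume : Measure (Config n))) := by
  have hm : AEStronglyMeasurable (fun z : Config n × Config n => φ z.1 * ψ z.2)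
      ((volume : Measure (Config n)).prod (volume : Measure (Config n))) :=
    (Lp.aestronglyMeasurable φ).comp_fst.mul (Lp.aestronglyMeasurable ψ).comp_snd
  rw [memLp_two_iff_integrable_sq_norm hm]
  have hφ := (memLp_two_iff_integrable_sq_norm (Lp.aestronglyMeasurable φ)).1 (Lp.memLp φ)
  have hψ := (memLp_two_iff_integrable_sq_norm (Lp.aestronglyMeasurable ψ)).1 (Lp.memLp ψ)
  simpa [mul_pow] using hφ.mul_prod hψ

/-- The product vector `φ ⊗ ψ`, i.e. the wave function `(x, y) ↦ φ(x) ψ(y)`. -/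
def tensor (φ ψ : ModeSpace n) : BipartiteSpace n := (memLp_tensor φ ψ).toLp _

theorem norm_sq_eq_integral {X : Type*} [MeasurableSpace X] {μ : Measure X} (f : Lp ℂ 2 μ) :
    ‖f‖ ^ 2 = ∫ x, ‖f x‖ ^ 2 ∂μ := by
  have h : ((‖f‖ ^ 2 : ℝ) : ℂ) = ((∫ x, ‖f x‖ ^ 2 ∂μ : ℝ) : ℂ) := by
    have := inner_self_eq_norm_sq_to_K (𝕜 := ℂ) f
    rw [L2.inner_def] at this
    rw [← integral_complex_ofReal]
    simpa [inner_self_eq_norm_sq_to_K] using this.symm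
  exact_mod_cast h

theorem norm_tensor (φ ψ : ModeSpace n) : ‖tensor φ ψ‖ = ‖φ‖ * ‖ψ‖ := by
  have key : ‖tensor φ ψ‖ ^ 2 = (‖φ‖ * ‖ψ‖) ^ 2 := by
    rw [mul_pow, norm_sq_eq_integral, norm_sq_eq_integral, norm_sq_eq_integral,
      ← integral_prod_mul]
    refine integral_congr_ae ?_
    filter_upwards [(memLp_tensor φ ψ).coeFn_toLp] with z hz
    simp only [tensor, hz, norm_mul, mul_pow]
  exact (sq_eq_sq₀ (norm_nonneg _) (by positivity)).1 key

/-- The operator `φ ↦ φ ⊗ ψ`. -/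
def tensorRight (ψ : ModeSpace n) : ModeSpace n →L[ℂ] BipartiteSpace n :=
  LinearMap.mkContinuous
    { toFun := fun φ => tensor φ ψ
      map_add' := fun f g => by
        unfold tensor
        rw [← MemLp.toLp_add]
        refine MemLp.toLp_congr _ _ ?_
        filter_upwards [Measure.quasiMeasurePreserving_fst.ae (Lp.coeFn_add f g)] with z hz
        simp only [hz, Pi.add_apply, add_mul]
      map_smul' := fun c f => by
        unfold tensor
        rw [RingHom.id_apply, ← MemLp.toLp_const_smul]
        refine MemLp.toLp_congr _ _ ?_
        filter_upwards [Measure.quasiMeasurePreserving_fst.ae (Lp.coeFn_smul c f)] with z hz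
        simp [hz, mul_assoc] }
    ‖ψ‖ (fun φ => by
      change ‖tensor φ ψ‖ ≤ _
      rw [norm_tensor, mul_comm])

/-- The partial trace over the second tensor factor: `⟨φ, (tr₂ σ) φ'⟩ = ∑ₖ ⟨φ ⊗ eₖ, σ (φ' ⊗ eₖ)⟩`
for an orthonormal basis `eₖ` of the second factor. For trace-class `σ` the series of operators
converges absolutely in norm and its sum does not depend on the basis. -/
def partialTraceSnd (σ : BipartiteSpace n →L[ℂ] BipartiteSpace n) :
    ModeSpace n →L[ℂ] ModeSpace n :=
  ∑' k, adjoint (tensorRight (basis (ModeSpace n) k)) ∘L σ ∘L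
    tensorRight (basis (ModeSpace n) k)

/-- The partial transpose `ρ^{T_B}` over the second tensor factor, transposition being taken with
respect to the position (equivalently, since Hermite functions are real, the Fock) basis:
`⟨φ ⊗ ψ, ρ^{T_B} (φ' ⊗ ψ')⟩ = ⟨φ ⊗ conj ψ', ρ (φ' ⊗ conj ψ)⟩`.
The vectors `conj eⱼ` form again an orthonormal basis, and the `(j, k)` summand is the block of
`ρ^{T_B}` between `conj eₖ` and `conj eⱼ`, equal to the block of `ρ` between `eⱼ` and `eₖ`. For
trace-class `ρ` the series converges unconditionally in operator norm. -/
def partialTransposeB (ρ : BipartiteSpace n →L[ℂ] BipartiteSpace n) :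
    BipartiteSpace n →L[ℂ] BipartiteSpace n :=
  ∑' p : basisIndex (ModeSpace n) × basisIndex (ModeSpace n),
    tensorRight (star (basis (ModeSpace n) p.2)) ∘L
      (adjoint (tensorRight (basis (ModeSpace n) p.1)) ∘L ρ ∘L
        tensorRight (basis (ModeSpace n) p.2)) ∘L
      adjoint (tensorRight (star (basis (ModeSpace n) p.1)))

/-! ### Collective modes -/

/-- The change of coordinates `(u, v) ↦ ((u + v)/√2, (u - v)/√2)` between `(x_+, x_-)` and
`(x_A, x_B)`; it is its own inverse. -/
def collective (n : ℕ) : Config n × Config n →ₗ[ℝ] Config n × Config n :=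
  (√2)⁻¹ • LinearMap.prod (LinearMap.fst ℝ _ _ + LinearMap.snd ℝ _ _)
    (LinearMap.fst ℝ _ _ - LinearMap.snd ℝ _ _)

theorem collective_comp_self (n : ℕ) : collective n ∘ₗ collective n = LinearMap.id := by
  have h : (√2)⁻¹ * (√2)⁻¹ = (2 : ℝ)⁻¹ := by
    rw [← mul_inv, Real.mul_self_sqrt (by norm_num)]
  refine LinearMap.ext fun z => Prod.ext ?_ ?_
  · change (√2)⁻¹ • ((√2)⁻¹ • (z.1 + z.2) + (√2)⁻¹ • (z.1 - z.2)) = z.1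
    rw [← smul_add, smul_smul, h]
    module
  · change (√2)⁻¹ • ((√2)⁻¹ • (z.1 + z.2) - (√2)⁻¹ • (z.1 - z.2)) = z.2
    rw [← smul_sub, smul_smul, h]
    module

theorem measurePreserving_collective (n : ℕ) :
    MeasurePreserving (collective n)
      ((volume : Measure (Config n)).prod (volume : Measure (Config n)))
      ((volume : Measure (Config n)).prod (volume : Measure (Config n))) := by
  have hd : LinearMap.det (collective n) * LinearMap.det (collective n) = 1 := by
    rw [← LinearMap.det_comp, collective_comp_self, LinearMap.det_id]
  have h0 : LinearMap.det (collective n) ≠ 0 := fun h => by simp [h] at hd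
  refine ⟨(collective n).continuous_of_finiteDimensional.measurable, ?_⟩
  rw [Measure.map_linearMap_addHaar_eq_smul_addHaar _ h0]
  rcases mul_self_eq_one_iff.1 hd with h | h <;> simp [h]

/-- The unitary that passes to the tensor decomposition into the collective modes
`a_± = (a_A ± a_B)/√2`: `(U ψ)(x_+, x_-) = ψ((x_+ + x_-)/√2, (x_+ - x_-)/√2)`, so that
`U a_+ U† = a ⊗ 1` and `U a_- U† = 1 ⊗ a`. -/
def collectiveUnitary (n : ℕ) : BipartiteSpace n →L[ℂ] BipartiteSpace n :=
  (Lp.compMeasurePreservingₗᵢ ℂ (collective n)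
    (measurePreserving_collective n)).toContinuousLinearMap

/-- The partial trace `tr_- ρ` over the collective modes `a_- = (a_A - a_B)/√2`, a state of the
modes `a_+ = (a_A + a_B)/√2`. -/
def traceMinus (ρ : BipartiteSpace n →L[ℂ] BipartiteSpace n) : ModeSpace n →L[ℂ] ModeSpace n :=
  partialTraceSnd (collectiveUnitary n ∘L ρ ∘L adjoint (collectiveUnitary n))

end Bipartite

end WignerPPT

end

open scoped ComplexOrder

noncomputable section

namespace WignerPPT

open MeasureTheory Complex ContinuousLinearMap

/-! Up to a positive factor the Wigner function of `tr_- ρ` at `α` is the trace of `U ρ U†` against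
`R ⊗ 1`, where `R = D(α) Π D(α)†`. Written in the original modes, `R ⊗ 1` is the swap of the two
factors followed by `A ⊗ A`, with `A` the displaced parity at `α / √2`
(`reflectionFst_collectiveUnitary_tensor`). Evaluated in the orthonormal basis `A eⱼ ⊗ eₖ`, the
trace is `∑ ⟨A eⱼ ⊗ eₖ, ρ (A eₖ ⊗ eⱼ)⟩`. Partial transposition exchanges the two vectors in the
second slot up to conjugation, so each term is `⟨A eⱼ ⊗ conj eⱼ, ρ^{T_B} (A eₖ ⊗ conj eₖ)⟩`. Summed
over `j, k` in a finite set `s`, this is the quadratic form of `ρ^{T_B}` at `∑_{j ∈ s} A eⱼ ⊗ conj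
eⱼ`, hence nonnegative, and the Wigner value is a limit of such sums.

The analytic work is convergence. Writing `ρ = S† S` with `S` Hilbert–Schmidt turns every trace into
an absolutely convergent, basis-independent sum `∑ ⟨X bᵢ, Y bᵢ⟩` (`tsum_inner_eq_of_basis`). The
operator series defining the partial trace and partial transpose must be shown summable before their
matrix elements can be read off (`hasSum_inner_partialTraceSnd`, `inner_partialTransposeB`). -/

/-! ### Hilbert–Schmidt sums -/

section HilbertSchmidt

variable {E F : Type*} [NormedAddCommGroup E] [InnerProductSpace ℂ E]
  [NormedAddCommGroup F] [InnerProductSpace ℂ F] {ι κ : Type*}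

/-- Parseval's identity. -/
theorem hasSum_norm_inner_sq (b : HilbertBasis ι ℂ E) (x : E) :
    HasSum (fun i => ‖inner ℂ (b i) x‖ ^ 2) (‖x‖ ^ 2) := by
  have h := b.hasSum_inner_mul_inner x x
  have hi : ∀ i, inner ℂ x (b i) * inner ℂ (b i) x = ((‖inner ℂ (b i) x‖ ^ 2 : ℝ) : ℂ) := by
    intro i
    rw [← inner_conj_symm x (b i), ← Complex.normSq_eq_conj_mul_self, Complex.normSq_eq_norm_sq]
  have hx : inner ℂ x x = ((‖x‖ ^ 2 : ℝ) : ℂ) := by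
    rw [inner_self_eq_norm_sq_to_K]
    simp
  rw [hx] at h
  simp only [hi] at h
  exact Complex.hasSum_ofReal.1 h

/-- The matrix elements of an operator that is Hilbert–Schmidt are square summable. -/
theorem summable_norm_matrix_sq {X : E →L[ℂ] F} (b : HilbertBasis ι ℂ E) (c : HilbertBasis κ ℂ F)
    (hX : Summable fun i => ‖X (b i)‖ ^ 2) :
    Summable fun p : ι × κ => ‖inner ℂ (c p.2) (X (b p.1))‖ ^ 2 := by
  refine (summable_prod_of_nonneg fun p => by positivity).2
    ⟨fun i => (hasSum_norm_inner_sq c (X (b i))).summable, ?_⟩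
  simpa only [(hasSum_norm_inner_sq c _).tsum_eq] using hX

theorem mul_le_sq_add_sq {a b : ℝ} : a * b ≤ a ^ 2 + b ^ 2 := by
  nlinarith [sq_nonneg (a - b), sq_nonneg a, sq_nonneg b]

theorem summable_inner_of_norm_sq {f g : ι → E} (hf : Summable fun i => ‖f i‖ ^ 2)
    (hg : Summable fun i => ‖g i‖ ^ 2) : Summable fun i => inner ℂ (f i) (g i) := by
  refine Summable.of_norm_bounded (hf.add hg) fun i => (norm_inner_le_norm _ _).trans mul_le_sq_add_sq

/-- The image of an orthonormal basis under a surjective isometry. -/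
def mapBasis (b : HilbertBasis ι ℂ E) (L : E →L[ℂ] F) (hL : ∀ x, ‖L x‖ = ‖x‖)
    (hs : Function.Surjective L) : HilbertBasis ι ℂ F :=
  ⟨(LinearIsometryEquiv.ofSurjective ⟨L.toLinearMap, hL⟩ hs).symm.trans b.repr⟩

@[simp]
theorem mapBasis_apply (b : HilbertBasis ι ℂ E) (L : E →L[ℂ] F) (hL : ∀ x, ‖L x‖ = ‖x‖)
    (hs : Function.Surjective L) (i : ι) : mapBasis b L hL hs i = L (b i) := by
  classical
  rw [← HilbertBasis.repr_symm_single, ← HilbertBasis.repr_symm_single]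
  rfl

theorem summable_inner_mul_inner_prod {X Y : E →L[ℂ] F} (b : HilbertBasis ι ℂ E)
    (c : HilbertBasis κ ℂ F) (hX : Summable fun i => ‖X (b i)‖ ^ 2)
    (hY : Summable fun i => ‖Y (b i)‖ ^ 2) :
    Summable (Function.uncurry fun i j => inner ℂ (X (b i)) (c j) * inner ℂ (c j) (Y (b i))) := by
  refine Summable.of_norm_bounded
    ((summable_norm_matrix_sq b c hX).add (summable_norm_matrix_sq b c hY)) fun p => ?_
  rw [Function.uncurry_apply_pair, norm_mul, norm_inner_symm]
  exact mul_le_sq_add_sq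

variable [CompleteSpace E] [CompleteSpace F]

/-- Both sums are the sum of squared moduli of the same matrix elements, taken by rows or by
columns. -/
theorem summable_norm_adjoint_sq {X : E →L[ℂ] F} (b : HilbertBasis ι ℂ E) (c : HilbertBasis κ ℂ F)
    (hX : Summable fun i => ‖X (b i)‖ ^ 2) : Summable fun j => ‖adjoint X (c j)‖ ^ 2 := by
  have h := (summable_norm_matrix_sq b c hX).prod_symm.prod
  refine h.congr fun j => ?_
  rw [← (hasSum_norm_inner_sq b (adjoint X (c j))).tsum_eq]
  refine tsum_congr fun i => ?_
  rw [adjoint_inner_right, norm_inner_symm]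
  rfl

/-- Square summability of the images of an orthonormal basis does not depend on the basis. -/
theorem summable_norm_sq_of_basis {X : E →L[ℂ] F} (b : HilbertBasis ι ℂ E)
    (b' : HilbertBasis κ ℂ E) (hX : Summable fun i => ‖X (b i)‖ ^ 2) :
    Summable fun j => ‖X (b' j)‖ ^ 2 := by
  obtain ⟨w, c, -⟩ := exists_hilbertBasis ℂ F
  -- Two passages to the adjoint, through an auxiliary basis of `F`, replace `b` by `b'`.
  simpa using summable_norm_adjoint_sq c b' (summable_norm_adjoint_sq b c hX)

/-- After taking adjoints `V†` stands on the left, where its operator norm bounds each term. -/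
theorem summable_norm_comp_sq {X : E →L[ℂ] F} (b : HilbertBasis ι ℂ E) (V : E →L[ℂ] E)
    (hX : Summable fun i => ‖X (b i)‖ ^ 2) : Summable fun i => ‖(X ∘L V) (b i)‖ ^ 2 := by
  obtain ⟨w, c, -⟩ := exists_hilbertBasis ℂ F
  have h : Summable fun j => ‖adjoint (X ∘L V) (c j)‖ ^ 2 := by
    refine Summable.of_nonneg_of_le (fun j => by positivity) (fun j => ?_)
      ((summable_norm_adjoint_sq b c hX).mul_left (‖adjoint V‖ ^ 2))
    rw [adjoint_comp, comp_apply, ← mul_pow]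
    gcongr
    exact le_opNorm _ _
  simpa using summable_norm_adjoint_sq c b h

theorem tsum_inner_eq_tsum_inner_adjoint {X Y : E →L[ℂ] F} (b : HilbertBasis ι ℂ E)
    (c : HilbertBasis κ ℂ F) (hX : Summable fun i => ‖X (b i)‖ ^ 2)
    (hY : Summable fun i => ‖Y (b i)‖ ^ 2) :
    ∑' i, inner ℂ (X (b i)) (Y (b i)) = ∑' j, inner ℂ (adjoint Y (c j)) (adjoint X (c j)) := by
  have h1 : ∀ i, inner ℂ (X (b i)) (Y (b i)) =
      ∑' j, inner ℂ (X (b i)) (c j) * inner ℂ (c j) (Y (b i)) := fun i =>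
    (c.tsum_inner_mul_inner _ _).symm
  have h2 : ∀ j, inner ℂ (adjoint Y (c j)) (adjoint X (c j)) =
      ∑' i, inner ℂ (X (b i)) (c j) * inner ℂ (c j) (Y (b i)) := fun j => by
    rw [← b.tsum_inner_mul_inner]
    refine tsum_congr fun i => ?_
    rw [adjoint_inner_left, adjoint_inner_right, mul_comm]
  rw [tsum_congr h1, tsum_congr h2]
  exact (summable_inner_mul_inner_prod b c hX hY).tsum_comm.symm

/-- The trace `∑ᵢ ⟨X bᵢ, Y bᵢ⟩` of `X† Y` for Hilbert–Schmidt operators `X`, `Y` does not depend on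
the orthonormal basis. -/
theorem tsum_inner_eq_of_basis {X Y : E →L[ℂ] F} (b : HilbertBasis ι ℂ E)
    (b' : HilbertBasis κ ℂ E) (hX : Summable fun i => ‖X (b i)‖ ^ 2)
    (hY : Summable fun i => ‖Y (b i)‖ ^ 2) :
    ∑' i, inner ℂ (X (b i)) (Y (b i)) = ∑' j, inner ℂ (X (b' j)) (Y (b' j)) := by
  obtain ⟨w, c, -⟩ := exists_hilbertBasis ℂ F
  rw [tsum_inner_eq_tsum_inner_adjoint b c hX hY, tsum_inner_eq_tsum_inner_adjoint b' c
    (summable_norm_sq_of_basis b b' hX) (summable_norm_sq_of_basis b b' hY)]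

/-- The operator norm is bounded by the Hilbert–Schmidt norm. -/
theorem norm_sq_le_tsum {X : E →L[ℂ] F} (b : HilbertBasis ι ℂ E)
    (hX : Summable fun i => ‖X (b i)‖ ^ 2) : ‖X‖ ^ 2 ≤ ∑' i, ‖X (b i)‖ ^ 2 := by
  have h0 : 0 ≤ ∑' i, ‖X (b i)‖ ^ 2 := tsum_nonneg fun i => by positivity
  -- The adjoint is easier to bound: the coefficients of `X† y` in `b` are `⟨X bᵢ, y⟩`.
  rw [← LinearIsometryEquiv.norm_map adjoint X]
  refine (Real.le_sqrt (norm_nonneg _) h0).1 (opNorm_le_bound _ (Real.sqrt_nonneg _) fun y => ?_)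
  refine (sq_le_sq₀ (norm_nonneg _) (by positivity)).1 ?_
  rw [mul_pow, Real.sq_sqrt h0, ← (hasSum_norm_inner_sq b (adjoint X y)).tsum_eq, ← tsum_mul_right]
  refine Summable.tsum_le_tsum (fun i => ?_) (hasSum_norm_inner_sq b _).summable (hX.mul_right _)
  rw [adjoint_inner_right, ← mul_pow]
  gcongr
  exact norm_inner_le_norm _ _

theorem exists_eq_adjoint_comp_self {ρ : E →L[ℂ] E} (hρ : ρ.IsPositive) :
    ∃ S : E →L[ℂ] E, ρ = adjoint S ∘L S :=
  CStarAlgebra.nonneg_iff_eq_star_mul_self.1 (nonneg_iff_isPositive ρ |>.2 hρ)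

/-- A density operator is `S† S` with `S` Hilbert–Schmidt. -/
theorem IsDensityOperator.exists_hilbertSchmidt {ρ : E →L[ℂ] E} (hρ : IsDensityOperator ρ) :
    ∃ S : E →L[ℂ] E, ρ = adjoint S ∘L S ∧ Summable fun i => ‖S (basis E i)‖ ^ 2 := by
  obtain ⟨S, rfl⟩ := exists_eq_adjoint_comp_self hρ.isPositive
  refine ⟨S, rfl, Complex.summable_ofReal.1 ?_⟩
  refine hρ.hasSum_trace.summable.congr fun i => ?_
  rw [comp_apply, adjoint_inner_right, inner_self_eq_norm_sq_to_K]
  simp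

end HilbertSchmidt

/-! ### Product vectors -/

section Tensor

variable {n : ℕ} {ι κ : Type*}

theorem coeFn_tensor (φ ψ : ModeSpace n) :
    tensor φ ψ =ᵐ[(volume : Measure (Config n)).prod volume] fun z => φ z.1 * ψ z.2 :=
  (memLp_tensor φ ψ).coeFn_toLp

theorem inner_tensor (φ ψ φ' ψ' : ModeSpace n) :
    inner ℂ (tensor φ ψ) (tensor φ' ψ') = inner ℂ φ φ' * inner ℂ ψ ψ' := by
  rw [L2.inner_def, L2.inner_def, L2.inner_def, ← integral_prod_mul]
  refine integral_congr_ae ?_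
  filter_upwards [coeFn_tensor φ ψ, coeFn_tensor φ' ψ'] with z h h'
  rw [h, h']
  simp only [RCLike.inner_apply, map_mul]
  ring

@[simp]
theorem tensorRight_apply (φ ψ : ModeSpace n) : tensorRight ψ φ = tensor φ ψ := rfl

theorem adjoint_tensorRight_tensor (ψ φ' ψ' : ModeSpace n) :
    adjoint (tensorRight ψ) (tensor φ' ψ') = inner ℂ ψ ψ' • φ' := by
  refine ext_inner_left ℂ fun φ => ?_
  rw [adjoint_inner_right, tensorRight_apply, inner_tensor, inner_smul_right, mul_comm]

theorem tensor_add_right (φ ψ ψ' : ModeSpace n) :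
    tensor φ (ψ + ψ') = tensor φ ψ + tensor φ ψ' := by
  unfold tensor
  rw [← MemLp.toLp_add]
  refine MemLp.toLp_congr _ _ ?_
  filter_upwards [Measure.quasiMeasurePreserving_snd.ae (Lp.coeFn_add ψ ψ')] with z hz
  simp only [hz, Pi.add_apply, mul_add]

theorem tensor_smul_right (c : ℂ) (φ ψ : ModeSpace n) :
    tensor φ (c • ψ) = c • tensor φ ψ := by
  unfold tensor
  rw [← MemLp.toLp_const_smul]
  refine MemLp.toLp_congr _ _ ?_
  filter_upwards [Measure.quasiMeasurePreserving_snd.ae (Lp.coeFn_smul c ψ)] with z hz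
  simp only [hz, Pi.smul_apply, smul_eq_mul, mul_left_comm]

/-- The operator `ψ ↦ φ ⊗ ψ`. -/
def tensorLeft (φ : ModeSpace n) : ModeSpace n →L[ℂ] BipartiteSpace n :=
  LinearMap.mkContinuous
    { toFun := tensor φ
      map_add' := tensor_add_right φ
      map_smul' := fun c => tensor_smul_right c φ }
    ‖φ‖ fun ψ => (norm_tensor φ ψ).le

@[simp]
theorem tensorLeft_apply (φ ψ : ModeSpace n) : tensorLeft φ ψ = tensor φ ψ := rfl

/-- A function on a product of finite measure spaces whose integrals over all measurable rectangles
vanish is almost everywhere zero. -/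
theorem ae_eq_zero_of_forall_setIntegral_prod_eq_zero {X Y : Type*} [MeasurableSpace X]
    [MeasurableSpace Y] {μ : Measure X} {ν : Measure Y} [IsFiniteMeasure μ] [IsFiniteMeasure ν]
    {f : X × Y → ℂ} (hf : Integrable f (μ.prod ν))
    (h : ∀ s t, MeasurableSet s → MeasurableSet t → ∫ z in s ×ˢ t, f z ∂μ.prod ν = 0) :
    f =ᵐ[μ.prod ν] 0 := by
  refine Integrable.ae_eq_zero_of_forall_setIntegral_eq_zero hf fun s hs _ => ?_
  induction s, hs using MeasurableSpace.induction_on_inter generateFrom_prod.symm isPiSystem_prod with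
  | empty => simp
  | basic s hs =>
    obtain ⟨s, hs, t, ht, rfl⟩ := hs
    exact h s t hs ht
  | compl s hs ih =>
    have huniv := h Set.univ Set.univ .univ .univ
    rw [Set.univ_prod_univ, setIntegral_univ] at huniv
    have := integral_add_compl hs hf
    rwa [ih (measure_lt_top _ _), zero_add, huniv] at this
  | iUnion s hd hs ih =>
    rw [integral_iUnion hs hd hf.integrableOn]
    simp [ih _ (measure_lt_top _ _)]

/-- Indicators of sets of finite volume are in `L²`, so pairing with their tensor products gives the
integrals of `f` over bounded-volume rectangles. These determine `f` on each square of an exhaustion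
of the whole space. -/
theorem eq_zero_of_forall_inner_tensor_eq_zero {f : BipartiteSpace n}
    (h : ∀ φ ψ, inner ℂ (tensor φ ψ) f = 0) : f = 0 := by
  refine (Lp.eq_zero_iff_ae_eq_zero).2 ?_
  have key : ∀ m : ℕ, ∀ᵐ z ∂((volume : Measure (Config n)).prod volume).restrict
      (spanningSets volume m ×ˢ spanningSets volume m), f z = 0 := by
    intro m
    set K := spanningSets (volume : Measure (Config n)) m
    have hK : MeasurableSet K := measurableSet_spanningSets _ _
    have hKt : volume K ≠ ⊤ := (measure_spanningSets_lt_top _ _).ne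
    have : IsFiniteMeasure ((volume : Measure (Config n)).restrict K) :=
      isFiniteMeasure_restrict.2 hKt
    rw [← Measure.prod_restrict]
    refine ae_eq_zero_of_forall_setIntegral_prod_eq_zero ?_ fun s t hs ht => ?_
    · have hf := (Lp.memLp f).mono_measure (Measure.restrict_le_self (s := K ×ˢ K))
      rw [← Measure.prod_restrict] at hf
      exact hf.integrable (by norm_num)
    · have hsK : volume (s ∩ K) ≠ ⊤ := measure_ne_top_of_subset Set.inter_subset_right hKt
      have htK : volume (t ∩ K) ≠ ⊤ := measure_ne_top_of_subset Set.inter_subset_right hKt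
      rw [Measure.prod_restrict, Measure.restrict_restrict (hs.prod ht), Set.prod_inter_prod,
        ← integral_indicator ((hs.inter hK).prod (ht.inter hK))]
      rw [← h (indicatorConstLp 2 (hs.inter hK) hsK 1) (indicatorConstLp 2 (ht.inter hK) htK 1),
        L2.inner_def]
      refine integral_congr_ae ?_
      filter_upwards [coeFn_tensor (indicatorConstLp 2 (hs.inter hK) hsK (1 : ℂ))
          (indicatorConstLp 2 (ht.inter hK) htK 1),
        Measure.quasiMeasurePreserving_fst.ae (indicatorConstLp_coeFn (p := 2) (hs := hs.inter hK)
          (hμs := hsK) (c := (1 : ℂ))),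
        Measure.quasiMeasurePreserving_snd.ae (indicatorConstLp_coeFn (p := 2) (hs := ht.inter hK)
          (hμs := htK) (c := (1 : ℂ)))] with z h1 h2 h3
      rw [h1, h2, h3]
      by_cases hz1 : z.1 ∈ s ∩ K <;> by_cases hz2 : z.2 ∈ t ∩ K <;>
        simp [Set.indicator, Set.mem_prod, hz1, hz2]
  have hU : ⋃ m, spanningSets (volume : Measure (Config n)) m ×ˢ
      spanningSets (volume : Measure (Config n)) m = Set.univ := by
    refine Set.eq_univ_of_forall fun z => ?_
    obtain ⟨i, hi⟩ := Set.mem_iUnion.1 ((iUnion_spanningSets (volume : Measure (Config n))).ge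
      (Set.mem_univ z.1))
    obtain ⟨j, hj⟩ := Set.mem_iUnion.1 ((iUnion_spanningSets (volume : Measure (Config n))).ge
      (Set.mem_univ z.2))
    exact Set.mem_iUnion.2 ⟨max i j, monotone_spanningSets _ (le_max_left i j) hi,
      monotone_spanningSets _ (le_max_right i j) hj⟩
  have := (ae_restrict_iUnion_iff _ _).2 key
  rwa [hU, Measure.restrict_univ] at this

theorem orthonormal_tensor {b : ι → ModeSpace n} {c : κ → ModeSpace n} (hb : Orthonormal ℂ b)
    (hc : Orthonormal ℂ c) : Orthonormal ℂ fun p : ι × κ => tensor (b p.1) (c p.2) := by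
  classical
  rw [orthonormal_iff_ite] at *
  intro p p'
  rw [inner_tensor, hb, hc]
  by_cases h1 : p.1 = p'.1 <;> by_cases h2 : p.2 = p'.2 <;> simp [Prod.ext_iff, h1, h2]

theorem eq_zero_of_forall_inner_basis {E : Type*} [NormedAddCommGroup E] [InnerProductSpace ℂ E]
    (b : HilbertBasis ι ℂ E) {x : E} (h : ∀ i, inner ℂ (b i) x = 0) : x = 0 := by
  rw [← inner_self_eq_zero (𝕜 := ℂ), ← b.tsum_inner_mul_inner]
  simp [h]

/-- The orthonormal basis `bᵢ ⊗ cⱼ` of the bipartite space. -/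
def tensorBasis (b : HilbertBasis ι ℂ (ModeSpace n)) (c : HilbertBasis κ ℂ (ModeSpace n)) :
    HilbertBasis (ι × κ) ℂ (BipartiteSpace n) :=
  HilbertBasis.mkOfOrthogonalEqBot (orthonormal_tensor b.orthonormal c.orthonormal) <| by
    rw [Submodule.eq_bot_iff]
    intro f hf
    have hbc : ∀ i j, inner ℂ (tensor (b i) (c j)) f = 0 := fun i j =>
      (Submodule.mem_orthogonal _ _).1 hf _ (Submodule.subset_span ⟨(i, j), rfl⟩)
    -- Totality one factor at a time: `⟨bᵢ ⊗ ψ, f⟩` pairs `ψ` with a vector whose `c`-coefficients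
    -- all vanish.
    have hb : ∀ ψ, adjoint (tensorRight ψ) f = 0 := fun ψ =>
      eq_zero_of_forall_inner_basis b fun i => by
        rw [adjoint_inner_right, tensorRight_apply, ← tensorLeft_apply, ← adjoint_inner_right,
          eq_zero_of_forall_inner_basis c (x := adjoint (tensorLeft (b i)) f) fun j => by
            rw [adjoint_inner_right, tensorLeft_apply, hbc], inner_zero_right]
    refine eq_zero_of_forall_inner_tensor_eq_zero fun φ ψ => ?_
    rw [← tensorRight_apply, ← adjoint_inner_right, hb, inner_zero_right]

@[simp]
theorem tensorBasis_apply (b : HilbertBasis ι ℂ (ModeSpace n)) (c : HilbertBasis κ ℂ (ModeSpace n))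
    (p : ι × κ) : tensorBasis b c p = tensor (b p.1) (c p.2) := by
  simp [tensorBasis]

theorem inner_star_star (f g : ModeSpace n) : inner ℂ (star f) (star g) = inner ℂ g f := by
  rw [L2.inner_def, L2.inner_def]
  refine integral_congr_ae ?_
  filter_upwards [Lp.coeFn_star f, Lp.coeFn_star g] with x hf hg
  rw [hf, hg]
  simp [mul_comm]

/-- Completeness of the conjugated family is not needed: the partial transpose is only tested on
vectors whose second factor belongs to it. -/
theorem orthonormal_star {b : ι → ModeSpace n} (hb : Orthonormal ℂ b) :
    Orthonormal ℂ fun i => star (b i) := by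
  classical
  rw [orthonormal_iff_ite] at *
  intro i j
  rw [inner_star_star, hb]
  simp [eq_comm]

end Tensor

/-! ### Convergence and matrix elements of the partial trace and the partial transpose -/

section Partial

variable {n : ℕ} {ι κ : Type*}

/-- Bessel's inequality for the components `(1 ⊗ ⟨fⱼ|) ξ` of a bipartite vector. -/
theorem sum_norm_adjoint_tensorRight_sq_le {f : κ → ModeSpace n} (hf : Orthonormal ℂ f)
    (ξ : BipartiteSpace n) (s : Finset κ) :
    ∑ j ∈ s, ‖adjoint (tensorRight (f j)) ξ‖ ^ 2 ≤ ‖ξ‖ ^ 2 := by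
  have hs := hasSum_sum fun j (_ : j ∈ s) =>
    hasSum_norm_inner_sq (basis (ModeSpace n)) (adjoint (tensorRight (f j)) ξ)
  refine hasSum_le_of_sum_le hs fun t => ?_
  rw [← Finset.sum_product']
  refine le_trans (le_of_eq (Finset.sum_congr rfl fun p _ => ?_))
    ((orthonormal_tensor (basis (ModeSpace n)).orthonormal hf).sum_inner_products_le ξ)
  rw [adjoint_inner_right, tensorRight_apply]

/-- Cauchy–Schwarz, after which `t` is enlarged to the product of its projections so that the sum of
`(uₖ vⱼ)²` factors. -/
theorem sum_mul_mul_le_sqrt {u v : κ → ℝ} {x y : ℝ} (hx : 0 ≤ x) (hy : 0 ≤ y)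
    (hu : ∀ s : Finset κ, ∑ k ∈ s, u k ^ 2 ≤ x ^ 2) (hv : ∀ s : Finset κ, ∑ j ∈ s, v j ^ 2 ≤ y ^ 2)
    (r : κ × κ → ℝ) (t : Finset (κ × κ)) :
    ∑ p ∈ t, r p * (u p.2 * v p.1) ≤ √(∑ p ∈ t, r p ^ 2) * (x * y) := by
  classical
  refine (Real.sum_mul_le_sqrt_mul_sqrt _ _ _).trans
    (mul_le_mul_of_nonneg_left ((Real.sqrt_le_left (by positivity)).2 ?_) (Real.sqrt_nonneg _))
  calc ∑ p ∈ t, (u p.2 * v p.1) ^ 2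
      ≤ ∑ p ∈ t.image Prod.fst ×ˢ t.image Prod.snd, (u p.2 * v p.1) ^ 2 :=
        Finset.sum_le_sum_of_subset_of_nonneg Finset.subset_product fun p _ _ => by positivity
    _ = (∑ k ∈ t.image Prod.snd, u k ^ 2) * ∑ j ∈ t.image Prod.fst, v j ^ 2 := by
        rw [mul_comm, Finset.sum_mul_sum, ← Finset.sum_product']
        exact Finset.sum_congr rfl fun p _ => by ring
    _ ≤ x ^ 2 * y ^ 2 := mul_le_mul (hu _) (hv _)
        (Finset.sum_nonneg fun p _ => by positivity) (by positivity)
    _ = (x * y) ^ 2 := by ring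

theorem norm_inner_blocks_le {f : κ → ModeSpace n} (R : κ × κ → ModeSpace n →L[ℂ] ModeSpace n)
    (t : Finset (κ × κ)) (η ξ : BipartiteSpace n) :
    ‖inner ℂ η ((∑ p ∈ t, tensorRight (f p.2) ∘L R p ∘L adjoint (tensorRight (f p.1))) ξ)‖ ≤
      ∑ p ∈ t, ‖R p‖ *
        (‖adjoint (tensorRight (f p.2)) η‖ * ‖adjoint (tensorRight (f p.1)) ξ‖) := by
  rw [sum_apply, inner_sum]
  refine norm_sum_le_of_le _ fun p _ => ?_
  rw [comp_apply, comp_apply, ← adjoint_inner_left, mul_left_comm]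
  exact (norm_inner_le_norm _ _).trans
    (mul_le_mul_of_nonneg_left (le_opNorm _ _) (norm_nonneg _))

/-- A block operator is bounded by the `ℓ²` norm of its block norms, by Cauchy–Schwarz and Bessel.
This turns square summability of the blocks into the Cauchy criterion for the operator series. -/
theorem norm_sum_blocks_le {f : κ → ModeSpace n} (hf : Orthonormal ℂ f)
    (R : κ × κ → ModeSpace n →L[ℂ] ModeSpace n) (t : Finset (κ × κ)) :
    ‖∑ p ∈ t, tensorRight (f p.2) ∘L R p ∘L adjoint (tensorRight (f p.1))‖ ^ 2 ≤
      ∑ p ∈ t, ‖R p‖ ^ 2 := by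
  have h0 : 0 ≤ ∑ p ∈ t, ‖R p‖ ^ 2 := Finset.sum_nonneg fun p _ => by positivity
  refine (Real.le_sqrt (norm_nonneg _) h0).1 (opNorm_le_bound _ (Real.sqrt_nonneg _) fun ξ => ?_)
  have h1 := fun η => (norm_inner_blocks_le (f := f) R t η ξ).trans <|
    sum_mul_mul_le_sqrt (norm_nonneg η) (norm_nonneg ξ)
      (sum_norm_adjoint_tensorRight_sq_le hf η) (sum_norm_adjoint_tensorRight_sq_le hf ξ)
      (fun p => ‖R p‖) t
  -- The image is tested against itself, and one factor `‖η‖` is cancelled when nonzero.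
  generalize (∑ p ∈ t, tensorRight (f p.2) ∘L R p ∘L adjoint (tensorRight (f p.1))) ξ = η at h1 ⊢
  have h2 := h1 η
  rw [inner_self_eq_norm_sq_to_K, norm_pow, RCLike.norm_ofReal, abs_norm] at h2
  rcases (norm_nonneg η).eq_or_lt with h | h
  · rw [← h]
    positivity
  · refine le_of_mul_le_mul_left ?_ h
    linarith

theorem summable_blocks {f : κ → ModeSpace n} (hf : Orthonormal ℂ f)
    {R : κ × κ → ModeSpace n →L[ℂ] ModeSpace n} (hR : Summable fun p => ‖R p‖ ^ 2) :
    Summable fun p : κ × κ => tensorRight (f p.2) ∘L R p ∘L adjoint (tensorRight (f p.1)) := by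
  rw [summable_iff_vanishing_norm] at *
  intro ε hε
  obtain ⟨s, hs⟩ := hR (ε ^ 2) (by positivity)
  refine ⟨s, fun t ht => ?_⟩
  refine (sq_lt_sq₀ (norm_nonneg _) hε.le).1 ((norm_sum_blocks_le hf R t).trans_lt ?_)
  exact (le_abs_self _).trans_lt (hs t ht)

/-- The matrix element of a convergent operator sum as the sum of the matrix elements. -/
theorem inner_tsum_apply {E F : Type*} [NormedAddCommGroup E] [InnerProductSpace ℂ E]
    [NormedAddCommGroup F] [InnerProductSpace ℂ F] {T : ι → E →L[ℂ] F} (hT : Summable T) (x : F)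
    (y : E) : HasSum (fun i => inner ℂ x (T i y)) (inner ℂ x ((∑' i, T i) y)) :=
  (innerSL ℂ x ∘L ContinuousLinearMap.apply ℂ F y).hasSum hT.hasSum

theorem inner_tsum_blocks {f : κ → ModeSpace n} (hf : Orthonormal ℂ f)
    {R : κ × κ → ModeSpace n →L[ℂ] ModeSpace n} (hR : Summable fun p => ‖R p‖ ^ 2)
    (φ φ' : ModeSpace n) (j k : κ) :
    inner ℂ (tensor φ (f k))
      ((∑' p : κ × κ, tensorRight (f p.2) ∘L R p ∘L adjoint (tensorRight (f p.1)))
        (tensor φ' (f j))) = inner ℂ φ (R (j, k) φ') := by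
  classical
  have hfi := orthonormal_iff_ite.1 hf
  rw [← (inner_tsum_apply (summable_blocks hf hR) _ _).tsum_eq, tsum_eq_single (j, k)]
  · simp only [comp_apply]
    rw [← adjoint_inner_left, adjoint_tensorRight_tensor, adjoint_tensorRight_tensor]
    rw [hfi, hfi]
    simp
  · intro p hp
    simp only [comp_apply]
    rw [← adjoint_inner_left, adjoint_tensorRight_tensor, adjoint_tensorRight_tensor, hfi, hfi]
    by_cases h1 : p.1 = j
    · have h2 : p.2 ≠ k := fun h2 => hp (Prod.ext h1 h2)
      simp [h2]
    · simp [h1]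

/-- Each slice has operator norm at most its Hilbert–Schmidt norm, and the squares of the latter add
up to that of `S`. -/
theorem summable_norm_comp_tensorRight_sq {S : BipartiteSpace n →L[ℂ] BipartiteSpace n}
    (b : HilbertBasis ι ℂ (BipartiteSpace n)) (hS : Summable fun i => ‖S (b i)‖ ^ 2)
    (e : HilbertBasis κ ℂ (ModeSpace n)) :
    Summable fun k => ‖S ∘L tensorRight (e k)‖ ^ 2 := by
  have h := (summable_norm_sq_of_basis b (tensorBasis e e) hS).prod_symm
  refine Summable.of_nonneg_of_le (fun k => by positivity) (fun k => ?_) h.prod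
  refine (norm_sq_le_tsum e ?_).trans_eq ?_
  · simpa using h.prod_factor k
  · simp

theorem norm_block_le (S : BipartiteSpace n →L[ℂ] BipartiteSpace n) (ψ ψ' : ModeSpace n) :
    ‖adjoint (tensorRight ψ) ∘L (adjoint S ∘L S) ∘L tensorRight ψ'‖ ≤
      ‖S ∘L tensorRight ψ‖ * ‖S ∘L tensorRight ψ'‖ := by
  have h : adjoint (tensorRight ψ) ∘L (adjoint S ∘L S) ∘L tensorRight ψ' =
      adjoint (S ∘L tensorRight ψ) ∘L (S ∘L tensorRight ψ') := by
    rw [adjoint_comp]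
    rfl
  rw [h, ← LinearIsometryEquiv.norm_map adjoint (S ∘L tensorRight ψ)]
  exact opNorm_comp_le _ _

theorem hasSum_inner_partialTraceSnd {S : BipartiteSpace n →L[ℂ] BipartiteSpace n}
    (b : HilbertBasis ι ℂ (BipartiteSpace n)) (hS : Summable fun i => ‖S (b i)‖ ^ 2)
    (φ φ' : ModeSpace n) :
    HasSum (fun k => inner ℂ (S (tensor φ (basis (ModeSpace n) k)))
      (S (tensor φ' (basis (ModeSpace n) k))))
      (inner ℂ φ (partialTraceSnd (adjoint S ∘L S) φ')) := by
  have hs : Summable fun k => adjoint (tensorRight (basis (ModeSpace n) k)) ∘L (adjoint S ∘L S) ∘L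
      tensorRight (basis (ModeSpace n) k) :=
    Summable.of_norm_bounded (summable_norm_comp_tensorRight_sq b hS (basis (ModeSpace n)))
      fun k => (norm_block_le S _ _).trans_eq (sq _).symm
  have h := inner_tsum_apply hs φ φ'
  simp only [comp_apply, adjoint_inner_right, tensorRight_apply] at h
  exact h

/-- Block norms are at most products of two square-summable slice norms, so the defining series
converges; orthonormality then isolates the `(j, k)` block. -/
theorem inner_partialTransposeB {S : BipartiteSpace n →L[ℂ] BipartiteSpace n}
    (b : HilbertBasis ι ℂ (BipartiteSpace n)) (hS : Summable fun i => ‖S (b i)‖ ^ 2)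
    (φ φ' : ModeSpace n) (j k : basisIndex (ModeSpace n)) :
    inner ℂ (tensor φ (star (basis (ModeSpace n) k)))
      (partialTransposeB (adjoint S ∘L S) (tensor φ' (star (basis (ModeSpace n) j)))) =
    inner ℂ (S (tensor φ (basis (ModeSpace n) j))) (S (tensor φ' (basis (ModeSpace n) k))) := by
  have hs := summable_norm_comp_tensorRight_sq b hS (basis (ModeSpace n))
  refine (inner_tsum_blocks (orthonormal_star (basis (ModeSpace n)).orthonormal)
    (R := fun p => adjoint (tensorRight (basis (ModeSpace n) p.1)) ∘L (adjoint S ∘L S) ∘L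
      tensorRight (basis (ModeSpace n) p.2)) ?_ φ φ' j k).trans ?_
  · refine Summable.of_nonneg_of_le (fun p => by positivity) (fun p => ?_)
      (hs.mul_of_nonneg hs (fun _ => by positivity) fun _ => by positivity)
    rw [← mul_pow]
    exact pow_le_pow_left₀ (norm_nonneg _) (norm_block_le S _ _) 2
  · simp only [comp_apply, adjoint_inner_right, tensorRight_apply]

end Partial

/-! ### Displaced parity operators -/

section Reflection

variable {n : ℕ}

theorem coeFn_phaseMul {X : Type*} [MeasurableSpace X] {μ : Measure X} {θ : X → ℝ}
    (hθ : Measurable θ) (f : Lp ℂ 2 μ) : phaseMul θ hθ f =ᵐ[μ] fun x => exp (θ x * I) * f x :=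
  (memLp_phase_mul hθ f).coeFn_toLp

theorem coeFn_translation (q : Config n) (f : ModeSpace n) :
    translation q f =ᵐ[volume] fun x => f (x - q) :=
  Lp.coeFn_compMeasurePreserving f (measurePreserving_sub_right volume q)

theorem coeFn_parity (f : ModeSpace n) : parity n f =ᵐ[volume] fun x => f (-x) :=
  Lp.coeFn_compMeasurePreserving f (Measure.measurePreserving_neg volume)

theorem coeFn_displacement (α : Fin n → ℂ) (f : ModeSpace n) :
    displacement α f =ᵐ[volume] fun x =>
      exp ((inner ℝ (mom α) x - inner ℝ (mom α) (pos α) / 2 : ℝ) * I) * f (x - pos α) := by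
  refine (coeFn_phaseMul (by fun_prop) (translation (pos α) f)).trans ?_
  filter_upwards [coeFn_translation (pos α) f] with x hx
  rw [hx]

theorem norm_displacement (α : Fin n → ℂ) (f : ModeSpace n) : ‖displacement α f‖ = ‖f‖ :=
  (LinearIsometry.norm_map (phaseMul _ (by fun_prop)) (translation (pos α) f)).trans
    (LinearIsometry.norm_map _ f)

theorem norm_parity (f : ModeSpace n) : ‖parity n f‖ = ‖f‖ := LinearIsometry.norm_map _ _

theorem parity_parity (f : ModeSpace n) : parity n (parity n f) = f := by
  refine Lp.ext ?_
  filter_upwards [coeFn_parity (parity n f),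
    (Measure.measurePreserving_neg (volume : Measure (Config n))).quasiMeasurePreserving.ae
      (coeFn_parity f)] with x h1 h2
  rw [h1, h2, neg_neg]

theorem pos_neg (α : Fin n → ℂ) : pos (-α) = -pos α := by
  ext m
  simp [pos]

theorem mom_neg (α : Fin n → ℂ) : mom (-α) = -mom α := by
  ext m
  simp [mom]

theorem pos_smul (c : ℝ) (α : Fin n → ℂ) : pos (c • α) = c • pos α := by
  ext m
  simp [pos, mul_left_comm]

theorem mom_smul (c : ℝ) (α : Fin n → ℂ) : mom (c • α) = c • mom α := by
  ext m
  simp [mom, mul_left_comm]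

theorem displacement_displacement_neg (α : Fin n → ℂ) (f : ModeSpace n) :
    displacement α (displacement (-α) f) = f := by
  refine Lp.ext ?_
  filter_upwards [coeFn_displacement α (displacement (-α) f),
    (measurePreserving_sub_right (volume : Measure (Config n)) (pos α)).quasiMeasurePreserving.ae
      (coeFn_displacement (-α) f)] with x h1 h2
  rw [h1, h2, ← mul_assoc, ← exp_add, pos_neg, mom_neg, sub_neg_eq_add, sub_add_cancel, ← add_mul,
    ← ofReal_add]
  have : inner ℝ (mom α) x - inner ℝ (mom α) (pos α) / 2 +
      (inner ℝ (-mom α) (x - pos α) - inner ℝ (-mom α) (-pos α) / 2) = 0 := by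
    simp only [inner_neg_left, inner_neg_right, inner_sub_right]
    ring
  rw [this]
  simp

/-- The adjoint of an isometry is a left inverse, so it equals any right inverse. -/
theorem adjoint_displacement (α : Fin n → ℂ) : adjoint (displacement α) = displacement (-α) := by
  have h := (norm_map_iff_adjoint_comp_self (displacement α)).1 (norm_displacement α)
  ext1 f
  conv_lhs => rw [← displacement_displacement_neg α f]
  exact DFunLike.congr_fun h _

/-- The displaced parity operator `D(α) Π D(α)†`. -/
def reflection (α : Fin n → ℂ) : ModeSpace n →L[ℂ] ModeSpace n :=
  displacement α ∘L parity n ∘L adjoint (displacement α)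

theorem reflection_apply (α : Fin n → ℂ) (f : ModeSpace n) :
    reflection α f = displacement α (parity n (displacement (-α) f)) := by
  rw [reflection, adjoint_displacement]
  rfl

theorem norm_reflection (α : Fin n → ℂ) (f : ModeSpace n) : ‖reflection α f‖ = ‖f‖ := by
  rw [reflection_apply, norm_displacement, norm_parity, norm_displacement]

theorem reflection_reflection (α : Fin n → ℂ) (f : ModeSpace n) :
    reflection α (reflection α f) = f := by
  have h := displacement_displacement_neg (-α)
  rw [neg_neg] at h
  rw [reflection_apply, reflection_apply, h, parity_parity, displacement_displacement_neg]

theorem coeFn_reflection (α : Fin n → ℂ) (f : ModeSpace n) :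
    reflection α f =ᵐ[volume] fun x =>
      exp ((2 * inner ℝ (mom α) (x - pos α) : ℝ) * I) * f ((2 : ℝ) • pos α - x) := by
  have hs := (measurePreserving_sub_right (volume : Measure (Config n))
    (pos α)).quasiMeasurePreserving
  have hn := (Measure.measurePreserving_neg (volume : Measure (Config n))).quasiMeasurePreserving
  rw [reflection_apply]
  filter_upwards [coeFn_displacement α (parity n (displacement (-α) f)),
    hs.ae (coeFn_parity (displacement (-α) f)),
    hs.ae (hn.ae (coeFn_displacement (-α) f))] with x h1 h2 h3
  rw [h1, h2, h3, ← mul_assoc, ← exp_add, pos_neg, mom_neg, ← add_mul, ← ofReal_add]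
  congr 1
  · congr 3
    simp only [inner_neg_left, inner_neg_right, inner_sub_right]
    ring
  · congr 1
    module

theorem coeFn_collectiveUnitary (f : BipartiteSpace n) :
    collectiveUnitary n f =ᵐ[(volume : Measure (Config n)).prod volume]
      fun z => f (collective n z) :=
  Lp.coeFn_compMeasurePreserving f (measurePreserving_collective n)

theorem norm_collectiveUnitary (f : BipartiteSpace n) : ‖collectiveUnitary n f‖ = ‖f‖ :=
  LinearIsometry.norm_map _ _

theorem collectiveUnitary_collectiveUnitary (f : BipartiteSpace n) :
    collectiveUnitary n (collectiveUnitary n f) = f := by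
  refine Lp.ext ?_
  filter_upwards [coeFn_collectiveUnitary (collectiveUnitary n f),
    (measurePreserving_collective n).quasiMeasurePreserving.ae (coeFn_collectiveUnitary f)]
    with z h1 h2
  rw [h1, h2]
  exact congrArg f (DFunLike.congr_fun (collective_comp_self n) z)

theorem adjoint_collectiveUnitary_apply (f : BipartiteSpace n) :
    adjoint (collectiveUnitary n) (collectiveUnitary n f) = f :=
  DFunLike.congr_fun
    ((norm_map_iff_adjoint_comp_self (collectiveUnitary n)).1 norm_collectiveUnitary) f

/-- The point reflection of the first coordinate, `(u, v) ↦ (2q - u, v)`, preserves volume. -/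
theorem measurePreserving_reflectFst (q : Config n) :
    MeasurePreserving (Prod.map (fun u : Config n => (2 : ℝ) • q - u) (id : Config n → Config n))
      ((volume : Measure (Config n)).prod volume) ((volume : Measure (Config n)).prod volume) :=
  (Measure.measurePreserving_sub_left (volume : Measure (Config n)) ((2 : ℝ) • q)).prod
    (MeasurePreserving.id (volume : Measure (Config n)))

/-- The operator `D(α) Π D(α)† ⊗ 1` on the bipartite space. -/
def reflectionFst (α : Fin n → ℂ) : BipartiteSpace n →L[ℂ] BipartiteSpace n :=
  (phaseMul (fun z : Config n × Config n => 2 * inner ℝ (mom α) (z.1 - pos α))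
    (by fun_prop)).toContinuousLinearMap ∘L
  (Lp.compMeasurePreservingₗᵢ ℂ _ (measurePreserving_reflectFst (pos α))).toContinuousLinearMap

theorem coeFn_reflectionFst (α : Fin n → ℂ) (f : BipartiteSpace n) :
    reflectionFst α f =ᵐ[(volume : Measure (Config n)).prod volume] fun z =>
      exp ((2 * inner ℝ (mom α) (z.1 - pos α) : ℝ) * I) * f ((2 : ℝ) • pos α - z.1, z.2) := by
  refine (coeFn_phaseMul (by fun_prop) _).trans ?_
  filter_upwards [Lp.coeFn_compMeasurePreserving f (measurePreserving_reflectFst (pos α))] with z hz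
  congr 1

theorem reflectionFst_tensor (α : Fin n → ℂ) (φ ψ : ModeSpace n) :
    reflectionFst α (tensor φ ψ) = tensor (reflection α φ) ψ := by
  refine Lp.ext ?_
  filter_upwards [coeFn_reflectionFst α (tensor φ ψ),
    (measurePreserving_reflectFst (pos α)).quasiMeasurePreserving.ae (coeFn_tensor φ ψ),
    coeFn_tensor (reflection α φ) ψ,
    Measure.quasiMeasurePreserving_fst.ae (coeFn_reflection α φ)] with z h1 h2 h3 h4
  simp only [Prod.map, id] at h2
  rw [h1, h2, h3, h4, mul_assoc]

/-- In the original modes, `D(α) Π D(α)†` on the collective modes `a_+` swaps the factors and acts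
on each of them by the displaced parity operator at `α / √2`. -/
theorem reflectionFst_collectiveUnitary_tensor (α : Fin n → ℂ) (φ ψ : ModeSpace n) :
    reflectionFst α (collectiveUnitary n (tensor (reflection ((√2)⁻¹ • α) φ) ψ)) =
      collectiveUnitary n (tensor (reflection ((√2)⁻¹ • α) ψ) φ) := by
  have hc : (√2)⁻¹ * (√2)⁻¹ = (2 : ℝ)⁻¹ := by
    rw [← mul_inv, Real.mul_self_sqrt (by norm_num)]
  have hU := (measurePreserving_collective n).quasiMeasurePreserving
  have hR := (measurePreserving_reflectFst (pos α)).quasiMeasurePreserving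
  refine Lp.ext ?_
  filter_upwards [coeFn_reflectionFst α
      (collectiveUnitary n (tensor (reflection ((√2)⁻¹ • α) φ) ψ)),
    hR.ae (coeFn_collectiveUnitary (tensor (reflection ((√2)⁻¹ • α) φ) ψ)),
    hR.ae (hU.ae (coeFn_tensor (reflection ((√2)⁻¹ • α) φ) ψ)),
    hR.ae (hU.ae (Measure.quasiMeasurePreserving_fst.ae (coeFn_reflection ((√2)⁻¹ • α) φ))),
    coeFn_collectiveUnitary (tensor (reflection ((√2)⁻¹ • α) ψ) φ),
    hU.ae (coeFn_tensor (reflection ((√2)⁻¹ • α) ψ) φ),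
    hU.ae (Measure.quasiMeasurePreserving_fst.ae (coeFn_reflection ((√2)⁻¹ • α) ψ))]
    with z h1 h2 h3 h4 h5 h6 h7
  obtain ⟨u, v⟩ := z
  simp only [Prod.map, id] at h2 h3 h4
  rw [h1, h2, h3, h4, h5, h6, h7, pos_smul, mom_smul]
  have hf : ∀ z : Config n × Config n, (collective n z).1 = (√2)⁻¹ • (z.1 + z.2) := fun _ => rfl
  have hs : ∀ z : Config n × Config n, (collective n z).2 = (√2)⁻¹ • (z.1 - z.2) := fun _ => rfl
  simp only [hf, hs]
  -- Reflecting `x_+` about `q` sends `x_A` to `√2 q - x_B`, which reflection about `q / √2` takes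
  -- to `x_B`: hence the swap. The phases agree because `(√2)⁻¹` enters the inner products twice.
  have e1 : (2 : ℝ) • (√2)⁻¹ • pos α - (√2)⁻¹ • ((2 : ℝ) • pos α - u + v) =
      (√2)⁻¹ • (u - v) := by module
  have e2 : (2 : ℝ) • (√2)⁻¹ • pos α - (√2)⁻¹ • (u + v) =
      (√2)⁻¹ • ((2 : ℝ) • pos α - u - v) := by module
  have e3 : 2 * inner ℝ (mom α) (u - pos α) + 2 * inner ℝ ((√2)⁻¹ • mom α)
        ((√2)⁻¹ • ((2 : ℝ) • pos α - u + v) - (√2)⁻¹ • pos α) =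
      2 * inner ℝ ((√2)⁻¹ • mom α) ((√2)⁻¹ • (u + v) - (√2)⁻¹ • pos α) := by
    rw [← smul_sub, ← smul_sub]
    simp only [inner_smul_left, inner_smul_right, inner_sub_right, inner_add_right, conj_trivial]
    linear_combination (2 * inner ℝ (mom α) (pos α) - 2 * inner ℝ (mom α) u) * 2 * hc
  rw [e1, e2, ← e3, ofReal_add, add_mul, exp_add]
  ring

end Reflection

/-! ### The Wigner function of the reduced state and the partial transpose -/

section Main

variable {n : ℕ}

/-- An unconditionally convergent double series whose square partial sums are nonnegative has a
nonnegative sum. -/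
theorem nonneg_of_hasSum_of_sum_product_nonneg {κ : Type*} {g : κ × κ → ℂ} {a : ℂ}
    (hg : HasSum g a) (h : ∀ s : Finset κ, 0 ≤ ∑ p ∈ s ×ˢ s, g p) : 0 ≤ a := by
  classical
  -- Squares are cofinal: every finite `t` lies in the square over the union of its projections.
  have ht : Filter.Tendsto (fun s : Finset κ => s ×ˢ s) Filter.atTop Filter.atTop := by
    refine Filter.tendsto_atTop.2 fun t => ?_
    filter_upwards [Filter.eventually_ge_atTop (t.image Prod.fst ∪ t.image Prod.snd)] with s hs
    exact Finset.subset_product.trans (Finset.product_subset_product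
      (Finset.subset_union_left.trans hs) (Finset.subset_union_right.trans hs))
  exact ge_of_tendsto' (Filter.Tendsto.comp hg ht) h

/-- This is `tr[(tr₂ σ) R] = tr[σ (R ⊗ 1)]` for `σ = X† X`: immediate in a product basis, then
carried to `c`, which will be `collectiveBasis α`. -/
theorem trace_partialTraceSnd_comp_reflection {ι κ : Type*}
    {X : BipartiteSpace n →L[ℂ] BipartiteSpace n} (b : HilbertBasis ι ℂ (BipartiteSpace n))
    (hX : Summable fun i => ‖X (b i)‖ ^ 2) (c : HilbertBasis κ ℂ (BipartiteSpace n))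
    (α : Fin n → ℂ) :
    trace (partialTraceSnd (adjoint X ∘L X) ∘L reflection α) =
      ∑' p, inner ℂ (X (c p)) (X (reflectionFst α (c p))) := by
  let d := tensorBasis (basis (ModeSpace n)) (basis (ModeSpace n))
  have hd := summable_norm_sq_of_basis b d hX
  have hY := summable_norm_comp_sq d (reflectionFst α) hd
  have h : ∀ i, inner ℂ (basis (ModeSpace n) i)
      ((partialTraceSnd (adjoint X ∘L X) ∘L reflection α) (basis (ModeSpace n) i)) =
      ∑' k, inner ℂ (X (d (i, k))) ((X ∘L reflectionFst α) (d (i, k))) := fun i => by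
    rw [comp_apply, ← (hasSum_inner_partialTraceSnd b hX _ _).tsum_eq]
    refine tsum_congr fun k => ?_
    rw [comp_apply, tensorBasis_apply, reflectionFst_tensor]
  rw [trace, tsum_congr h, ← (summable_inner_of_norm_sq hd hY).tsum_prod,
    tsum_inner_eq_of_basis d c hd hY]
  rfl

theorem reflection_surjective (α : Fin n → ℂ) : Function.Surjective (reflection α) :=
  fun f => ⟨_, reflection_reflection α f⟩

theorem collectiveUnitary_surjective : Function.Surjective (collectiveUnitary n) :=
  fun f => ⟨_, collectiveUnitary_collectiveUnitary f⟩

/-- The vectors `A eⱼ ⊗ eₖ`, with `A` the displaced parity operator at `α / √2`, expressed in the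
collective modes. -/
def collectiveBasis (α : Fin n → ℂ) :
    HilbertBasis (basisIndex (ModeSpace n) × basisIndex (ModeSpace n)) ℂ (BipartiteSpace n) :=
  mapBasis
    (tensorBasis (mapBasis (basis (ModeSpace n)) (reflection ((√2)⁻¹ • α)) (norm_reflection _)
      (reflection_surjective _)) (basis (ModeSpace n)))
    (collectiveUnitary n) norm_collectiveUnitary
    collectiveUnitary_surjective

theorem collectiveBasis_apply (α : Fin n → ℂ)
    (p : basisIndex (ModeSpace n) × basisIndex (ModeSpace n)) :
    collectiveBasis α p = collectiveUnitary n
      (tensor (reflection ((√2)⁻¹ • α) (basis (ModeSpace n) p.1)) (basis (ModeSpace n) p.2)) := by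
  rw [collectiveBasis, mapBasis_apply, tensorBasis_apply, mapBasis_apply]

/-- `tr[(tr_- ρ) D(α) Π D(α)†]` is the formal expectation value of `ρ^{T_B}` in the unnormalizable
vector `∑ⱼ A eⱼ ⊗ conj eⱼ`, with `A` the displaced parity operator at `α / √2`. -/
theorem hasSum_trace_traceMinus_comp_reflection {ρ : BipartiteSpace n →L[ℂ] BipartiteSpace n}
    (hρ : IsDensityOperator ρ) (α : Fin n → ℂ) :
    HasSum (fun p : basisIndex (ModeSpace n) × basisIndex (ModeSpace n) =>
      inner ℂ (tensor (reflection ((√2)⁻¹ • α) (basis (ModeSpace n) p.1))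
          (star (basis (ModeSpace n) p.1)))
        (partialTransposeB ρ (tensor (reflection ((√2)⁻¹ • α) (basis (ModeSpace n) p.2))
          (star (basis (ModeSpace n) p.2)))))
      (trace (traceMinus ρ ∘L reflection α)) := by
  obtain ⟨S, rfl, hS⟩ := hρ.exists_hilbertSchmidt
  have hX := summable_norm_comp_sq _ (adjoint (collectiveUnitary n)) hS
  have hσ : collectiveUnitary n ∘L (adjoint S ∘L S) ∘L adjoint (collectiveUnitary n) =
      adjoint (S ∘L adjoint (collectiveUnitary n)) ∘L (S ∘L adjoint (collectiveUnitary n)) := by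
    rw [adjoint_comp, adjoint_adjoint]
    rfl
  have hc : ∀ p, inner ℂ ((S ∘L adjoint (collectiveUnitary n)) (collectiveBasis α p))
      ((S ∘L adjoint (collectiveUnitary n)) (reflectionFst α (collectiveBasis α p))) =
      inner ℂ (tensor (reflection ((√2)⁻¹ • α) (basis (ModeSpace n) p.1))
          (star (basis (ModeSpace n) p.1)))
        (partialTransposeB (adjoint S ∘L S)
          (tensor (reflection ((√2)⁻¹ • α) (basis (ModeSpace n) p.2))
            (star (basis (ModeSpace n) p.2)))) := fun p => by
    rw [inner_partialTransposeB _ hS, collectiveBasis_apply,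
      reflectionFst_collectiveUnitary_tensor, comp_apply, comp_apply,
      adjoint_collectiveUnitary_apply, adjoint_collectiveUnitary_apply]
  rw [traceMinus, hσ, trace_partialTraceSnd_comp_reflection _ hX (collectiveBasis α),
    tsum_congr hc]
  refine Summable.hasSum (Summable.congr (summable_inner_of_norm_sq
    (summable_norm_sq_of_basis _ (collectiveBasis α) hX)
    (summable_norm_sq_of_basis _ (collectiveBasis α)
      (summable_norm_comp_sq _ (reflectionFst α) hX))) hc)

/-- In the order on `ℂ`, `0 ≤` includes reality; both properties pass to the limit from the
quadratic form of `ρ^{T_B}`. -/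
theorem wigner_traceMinus_nonneg {ρ : BipartiteSpace n →L[ℂ] BipartiteSpace n}
    (hρ : IsDensityOperator ρ) (hT : (partialTransposeB ρ).IsPositive) (α : Fin n → ℂ) :
    0 ≤ wigner (traceMinus ρ) α := by
  have hpi : (0 : ℂ) ≤ ((2 / Real.pi : ℝ) : ℂ) ^ n :=
    pow_nonneg (Complex.zero_le_real.2 (by positivity)) n
  refine mul_nonneg hpi ?_
  refine nonneg_of_hasSum_of_sum_product_nonneg (hasSum_trace_traceMinus_comp_reflection hρ α)
    fun s => ?_
  rw [Finset.sum_product]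
  -- Sesquilinearity collapses the sum over `s ×ˢ s` to a single diagonal value of `ρ^{T_B}`.
  simp only [← inner_sum, ← sum_inner, ← map_sum]
  exact hT.inner_nonneg_right _

end Main

end WignerPPT

end

/-- Let `ρ` be a state of `2n` modes, split equally into `A` and `B`. If the Wigner function of the
reduced state `tr_- ρ` is not everywhere nonnegative, then the partial transpose `ρ^{T_B}` is not
positive semidefinite. -/
theorem theorem2 (n : ℕ)
    (ρ : WignerPPT.BipartiteSpace n →L[ℂ] WignerPPT.BipartiteSpace n)
    (hρ : WignerPPT.IsDensityOperator ρ)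
    (hneg : ¬ ∀ α : Fin n → ℂ, 0 ≤ WignerPPT.wigner (WignerPPT.traceMinus ρ) α) :
    ¬ (WignerPPT.partialTransposeB ρ).IsPositive := fun hT =>
  hneg (WignerPPT.wigner_traceMinus_nonneg hρ hT)
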